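/- Let $X$ be a regular $T_1$ topological space with a point-countable base, i.e. a base $\mathcal B$ such that every point of $X$ belongs to only countably many members of $\mathcal B$. Then the following are equivalent: (1) there is a neighborhood assignment $U_x$ $(x\in X)$, i.e. a choice of a neighborhood $U_x$ of $x$ for each $x\in X$, such that for every infinite $Y\subseteq X$ there is $y\in Y$ for which $\{x\in Y : y\notin U_x\}$ is infinite; (2) $X$ is left-separated, i.e. there is a well-ordering $<$ of $X$ such that $\{y\in X : y<x\}$ is closed in $X$ for every $x\in X$; (3) $X\not\rightarrow(\omega+1)^2_3$, i.e. it is not the case that for every set $L$ of cardinality $3$ and every coloring $c:[X]^2\to L$ of the two-element subsets of $X$ there is a subspace $Y'\subseteq X$ homeomorphic to the ordinal $\omega+1$ with its order topology such that $c$ takes only one color on the two-element subsets of $Y'$. -/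

import Mathlib

open scoped Topology

/-- `B` is a base of the topology of `X`, every point of which lies in countably many members. -/
def IsPointCountableBase {X : Type*} [TopologicalSpace X] (B : Set (Set X)) : Prop :=
  TopologicalSpace.IsTopologicalBasis B ∧ ∀ x : X, {U ∈ B | x ∈ U}.Countable

/-- `X` has a well-ordering whose initial segments `{y | y < x}` are all closed. -/
def IsLeftSeparated (X : Type*) [TopologicalSpace X] : Prop :=
  ∃ r : X → X → Prop, IsWellOrder X r ∧ ∀ x : X, IsClosed {y : X | r y x}

/-- `X` has a neighborhood assignment `U` such that every infinite `Y ⊆ X` has a point `y`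
with `y ∉ U x` for infinitely many `x ∈ Y`. -/
def HasGSNeighborhoodAssignment (X : Type*) [TopologicalSpace X] : Prop :=
  ∃ U : X → Set X, (∀ x : X, U x ∈ 𝓝 x) ∧
    ∀ Y : Set X, Y.Infinite → ∃ y ∈ Y, {x ∈ Y | y ∉ U x}.Infinite

/-- The partition relation `X → (Y)^k_{l,t}`: for every set `L` of `l` colors and every coloring
of the `k`-element subsets of `X` by `L`, there are a subspace `Y'` of `X` homeomorphic to `Y` and
a set `T` of `t` colors such that all `k`-element subsets of `Y'` get their colors in `T`. -/
def TopArrow (X Y : Type*) [TopologicalSpace X] [TopologicalSpace Y] (k l t : ℕ) : Prop :=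
  ∀ L : Type, Cardinal.mk L = (l : Cardinal) → ∀ c : {v : Finset X // v.card = k} → L,
    ∃ (Y' : Set X) (T : Set L), Nonempty (Y' ≃ₜ Y) ∧ Cardinal.mk T = (t : Cardinal) ∧
      ∀ v : {v : Finset X // v.card = k}, (v.1 : Set X) ⊆ Y' → c v ∈ T

/-- The ordinal `ω + 1`, the set of all ordinals below it, with the order topology (for this
order-convex set of ordinals it is the subspace topology from the ordinals). -/
abbrev OmegaPlusOne : Type 1 := Set.Iio (Ordinal.omega0.{0} + 1)

open Set Filter

/-! ### Left-separation from countable-valued closure operations -/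

section LeftSeparated

variable {X : Type*}

/-! The hub is left-separation. It follows as soon as some countable-valued `F` on finite sets has
all its closed sets topologically closed (`isLeftSeparated_of_closedUnder`): split the space into an
increasing chain of smaller hulls and induct on cardinality. An assignment as in (1), shrunk to a
point-countable base, yields such an `F`; conversely, complements of initial segments form such an
assignment.

If `X` is not left-separated, every countable-valued `F` has a closed set `C` with a point `x` in
its closure but outside it. These pairs `(C, x)` act like elementary submodels, and a Ramsey
argument by induction on the colors (`exists_isHomogeneousSeq`) extracts a homogeneous convergent
sequence. A left-separating order, by contrast, defines a bad coloring through regularity. -/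

/-- `C` contains the values of `F` at all its finite subsets. -/
def ClosedUnder (F : Finset X → Set X) (C : Set X) : Prop :=
  ∀ t : Finset X, (t : Set X) ⊆ C → F t ⊆ C

/-- The stages of the construction of the least superset of `S` closed under `F`. -/
def hullStage (F : Finset X → Set X) (S : Set X) : ℕ → Set X
  | 0 => S
  | n + 1 => hullStage F S n ∪ ⋃ t : Finset (hullStage F S n),
      F (t.map (Function.Embedding.subtype _))

/-- The least superset of `S` closed under `F`. -/
def hull (F : Finset X → Set X) (S : Set X) : Set X := ⋃ n, hullStage F S n

theorem hullStage_mono (F : Finset X → Set X) (S : Set X) : Monotone (hullStage F S) :=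
  monotone_nat_of_le_succ fun _ => subset_union_left

theorem subset_hull (F : Finset X → Set X) (S : Set X) : S ⊆ hull F S :=
  subset_iUnion (hullStage F S) 0

theorem ClosedUnder.iUnion_of_directed {ι : Type*} [Nonempty ι] {F : Finset X → Set X}
    {C : ι → Set X} (hd : Directed (· ⊆ ·) C)
    (h : ∀ i, ∀ t : Finset X, (t : Set X) ⊆ C i → F t ⊆ ⋃ j, C j) :
    ClosedUnder F (⋃ i, C i) := by
  intro t ht
  obtain ⟨i, hi⟩ := hd.exists_mem_subset_of_finset_subset_biUnion ht
  exact h i t hi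

theorem closedUnder_hull (F : Finset X → Set X) (S : Set X) : ClosedUnder F (hull F S) := by
  classical
  refine ClosedUnder.iUnion_of_directed (hullStage_mono F S).directed_le fun n t ht => ?_
  refine Subset.trans ?_ (subset_iUnion _ (n + 1))
  intro z hz
  refine Or.inr (mem_iUnion.2 ⟨t.subtype (· ∈ hullStage F S n), ?_⟩)
  rwa [Finset.subtype_map_of_mem fun x hx => ht hx]

theorem hull_subset {F : Finset X → Set X} {S C : Set X} (hS : S ⊆ C) (hC : ClosedUnder F C) :
    hull F S ⊆ C := by
  refine iUnion_subset fun n => ?_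
  induction n with
  | zero => exact hS
  | succ n ih =>
    refine union_subset ih (iUnion_subset fun t => hC _ ?_)
    intro x hx
    obtain ⟨y, -, rfl⟩ := Finset.mem_map.1 (Finset.mem_coe.1 hx)
    exact ih y.2

theorem mk_hull_le {F : Finset X → Set X} (hF : ∀ t, (F t).Countable) (S : Set X) :
    Cardinal.mk (hull F S) ≤ max Cardinal.aleph0 (Cardinal.mk S) := by
  have hfin : ∀ A : Set X, Cardinal.mk (Finset A) ≤ max Cardinal.aleph0 (Cardinal.mk A) := by
    intro A
    rcases finite_or_infinite A with h | h
    · exact le_max_of_le_left Cardinal.mk_le_aleph0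
    · rw [Cardinal.mk_finset_of_infinite]
      exact le_max_right _ _
  have hstage : ∀ n, Cardinal.mk (hullStage F S n) ≤ max Cardinal.aleph0 (Cardinal.mk S) := by
    intro n
    induction n with
    | zero => exact le_max_right _ _
    | succ n ih =>
      refine (Cardinal.mk_union_le _ _).trans
        (Cardinal.add_le_of_le (le_max_left _ _) ih ?_)
      refine (Cardinal.mk_iUnion_le _).trans
        (Cardinal.mul_le_of_le (le_max_left _ _) ?_ ?_)
      · exact (hfin _).trans (max_le (le_max_left _ _) ih)
      · exact ciSup_le' fun t => le_max_of_le_left (hF _).le_aleph0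
  have h := Cardinal.mk_iUnion_le_lift (hullStage F S)
  rw [Cardinal.lift_uzero] at h
  refine h.trans (Cardinal.mul_le_of_le (le_max_left _ _) ?_ ?_)
  · simp
  · exact ciSup_le' fun n => by simpa using hstage n

variable [TopologicalSpace X]

/-- If the closedness of sets under some countable-valued `F` implies topological closedness,
then the sets closed under `F` are left-separated. -/
theorem ClosedUnder.exists_isWellOrder [T1Space X] {F : Finset X → Set X}
    (hF : ∀ t, (F t).Countable) (hcl : ∀ C, ClosedUnder F C → IsClosed C)
    (A : Set X) (hA : ClosedUnder F A) :
    ∃ r : A → A → Prop, IsWellOrder A r ∧ ∀ x : A, IsClosed {y : X | ∃ h : y ∈ A, r ⟨y, h⟩ x} := by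
  induction hκ : Cardinal.mk A using WellFoundedLT.induction generalizing A with
  | ind κ ih =>
  subst hκ
  rcases le_or_gt (Cardinal.mk A) Cardinal.aleph0 with hc | hc
  · obtain ⟨e, he⟩ := (Cardinal.mk_le_aleph0_iff.1 hc).exists_injective_nat
    refine ⟨fun a b => e a < e b, (RelEmbedding.preimage ⟨e, he⟩ (· < ·)).isWellOrder, fun x => ?_⟩
    refine Set.Finite.isClosed ?_
    have : ({a : A | e a < e x}).Finite := (finite_Iio (e x)).preimage he.injOn
    refine (this.image Subtype.val).subset ?_
    rintro y ⟨h, hy⟩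
    exact ⟨⟨y, h⟩, hy, rfl⟩
  · obtain ⟨s, hs, hord⟩ := Cardinal.exists_ord_eq A
    have htri : ∀ a b, s a b ∨ a = b ∨ s b a := trichotomous_of s
    have htrans : ∀ a b c, s a b → s b c → s a c := fun a b c => _root_.trans
    -- The order `s` has the least possible type, so its proper initial segments are smaller than
    -- `A`. As `A` is uncountable, so are the hulls `D a`.
    let D : A → Set X := fun a => hull F (Subtype.val '' {b : A | ¬ s a b})
    have hDA : ∀ a, D a ⊆ A := fun a =>
      hull_subset (by rintro _ ⟨b, -, rfl⟩; exact b.2) hA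
    have hDcl : ∀ a, ClosedUnder F (D a) := fun a => closedUnder_hull _ _
    have hDmono : ∀ a b, s a b → D a ⊆ D b := fun a b hab =>
      hull_subset (Subset.trans (image_mono fun c hc hbc => hc (htrans _ _ _ hab hbc))
        (subset_hull _ _)) (hDcl b)
    have hDcard : ∀ a, Cardinal.mk (D a) < Cardinal.mk A := by
      intro a
      refine (mk_hull_le hF _).trans_lt (max_lt hc (Cardinal.mk_image_le.trans_lt ?_))
      have hsub : {b : A | ¬ s a b} ⊆ {b | s b a} ∪ {a} := by
        intro b hb
        rcases htri a b with h | h | h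
        · exact absurd h hb
        · exact Or.inr h.symm
        · exact Or.inl h
      refine (Cardinal.mk_le_mk_of_subset hsub).trans_lt ((Cardinal.mk_union_le _ _).trans_lt
        (Cardinal.add_lt_of_lt hc.le ?_ ?_))
      · exact Cardinal.card_typein_lt (r := s) a hord
      · rw [Cardinal.mk_singleton]
        exact Cardinal.one_lt_aleph0.trans hc
    choose r hr hrcl using fun a => ih _ (hDcard a) (D a) (hDcl a) rfl
    have hmem : ∀ z : A, ∃ a, (z : X) ∈ D a := fun z =>
      ⟨z, subset_hull _ _ ⟨z, fun h => irrefl_of s z h, rfl⟩⟩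
    have hwf : WellFounded s := hs.wf
    -- Points are ordered by the first stage containing them, then by that stage's own order.
    let rk : A → A := fun z => hwf.min {a | (z : X) ∈ D a} (hmem z)
    have hrk : ∀ z : A, (z : X) ∈ D (rk z) := fun z => hwf.min_mem _ (hmem z)
    have hrk_min : ∀ (z : A) a, (z : X) ∈ D a → ¬ s a (rk z) := fun z a h =>
      hwf.not_lt_min _ h
    let g : A → Σ' a, D a := fun z => ⟨rk z, z, hrk z⟩
    have hg : Function.Injective g := by
      intro z w h
      exact Subtype.ext (congrArg (fun p : Σ' a, D a => (p.2 : X)) h)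
    have hwf' : WellFounded (InvImage (PSigma.Lex s r) g) :=
      InvImage.wf g ⟨fun p =>
        PSigma.lexAccessible (hwf.apply p.1) (fun a => (hr a).wf) p.2⟩
    have hiff : ∀ z w, InvImage (PSigma.Lex s r) g z w ↔
        s (rk z) (rk w) ∨ ∃ h : rk z = rk w, r (rk w) ⟨z, h ▸ hrk z⟩ ⟨w, hrk w⟩ := by
      intro z w
      have hrec : ∀ {a b : A} (h : a = b) (p : D a),
          (h.rec p : D b) = ⟨p, h ▸ p.2⟩ := by
        rintro a _ rfl p
        rfl
      rw [InvImage, PSigma.lex_iff]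
      simp only [g, hrec]
    refine ⟨InvImage (PSigma.Lex s r) g, ?_, ?_⟩
    · refine { wf := hwf', toTrichotomous := ⟨fun z w hzw hwz => hg ?_⟩ }
      change ¬ PSigma.Lex s r (g z) (g w) at hzw
      change ¬ PSigma.Lex s r (g w) (g z) at hwz
      generalize g z = p at hzw hwz ⊢
      generalize g w = q at hzw hwz ⊢
      obtain ⟨a, p⟩ := p
      obtain ⟨b, q⟩ := q
      rcases htri a b with h | rfl | h
      · exact absurd (PSigma.Lex.left _ _ h) hzw
      · rcases trichotomous_of (r a) p q with h | rfl | h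
        · exact absurd (PSigma.Lex.right _ h) hzw
        · rfl
        · exact absurd (PSigma.Lex.right _ h) hwz
      · exact absurd (PSigma.Lex.left _ _ h) hwz
    · intro x
      -- The last set may contain points of earlier stages; this is harmless, since those already
      -- lie in the union.
      have hset : {y : X | ∃ h : y ∈ A, InvImage (PSigma.Lex s r) g ⟨y, h⟩ x} =
          (⋃ b : {b // s b (rk x)}, D b) ∪ {y | ∃ h : y ∈ D (rk x), r (rk x) ⟨y, h⟩ ⟨x, hrk x⟩} := by
        ext y
        simp only [hiff]
        constructor
        · rintro ⟨hy, h | ⟨h, h'⟩⟩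
          · exact Or.inl (mem_iUnion.2 ⟨⟨_, h⟩, hrk ⟨y, hy⟩⟩)
          · exact Or.inr ⟨_, h'⟩
        · intro hy
          have hlow : (∃ b, s b (rk x) ∧ y ∈ D b) → ∃ h : y ∈ A, s (rk ⟨y, h⟩) (rk x) := by
            rintro ⟨b, hb, hyb⟩
            refine ⟨hDA _ hyb, ?_⟩
            rcases htri (rk ⟨y, hDA _ hyb⟩) b with h | h | h
            · exact htrans _ _ _ h hb
            · rwa [h]
            · exact absurd h (hrk_min _ _ hyb)
          by_cases hex : ∃ b, s b (rk x) ∧ y ∈ D b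
          · obtain ⟨h, h'⟩ := hlow hex
            exact ⟨h, Or.inl h'⟩
          · rcases hy with hy | ⟨hy, hlt⟩
            · obtain ⟨⟨b, hb⟩, hyb⟩ := mem_iUnion.1 hy
              exact absurd ⟨b, hb, hyb⟩ hex
            · refine ⟨hDA _ hy, Or.inr ⟨?_, hlt⟩⟩
              rcases htri (rk ⟨y, hDA _ hy⟩) (rk x) with h | h | h
              · exact absurd ⟨_, h, hrk ⟨y, hDA _ hy⟩⟩ hex
              · exact h
              · exact absurd h (hrk_min _ _ hy)
      rw [hset]
      refine IsClosed.union ?_ (hrcl _ _)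
      rcases isEmpty_or_nonempty {b // s b (rk x)} with h | h
      · rw [iUnion_of_empty]
        exact isClosed_empty
      · refine hcl _ (ClosedUnder.iUnion_of_directed ?_ fun b t ht =>
          (hDcl _ t ht).trans (subset_iUnion (fun b : {b // s b (rk x)} => D b) b))
        intro b c
        rcases htri b c with h | h | h
        · exact ⟨c, hDmono _ _ h, Subset.rfl⟩
        · exact ⟨c, by rw [Subtype.ext h], Subset.rfl⟩
        · exact ⟨b, Subset.rfl, hDmono _ _ h⟩

theorem isLeftSeparated_of_closedUnder [T1Space X] {F : Finset X → Set X}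
    (hF : ∀ t, (F t).Countable) (hcl : ∀ C, ClosedUnder F C → IsClosed C) :
    IsLeftSeparated X := by
  obtain ⟨r, hr, h⟩ := ClosedUnder.exists_isWellOrder hF hcl univ fun _ _ => subset_univ _
  refine ⟨fun x y => r ⟨x, mem_univ x⟩ ⟨y, mem_univ y⟩, ?_, fun x => ?_⟩
  · exact (RelEmbedding.preimage (Equiv.Set.univ X).symm.toEmbedding r).isWellOrder
  · simpa using h ⟨x, mem_univ x⟩

theorem IsLeftSeparated.hasGSNeighborhoodAssignment (h : IsLeftSeparated X) :
    HasGSNeighborhoodAssignment X := by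
  obtain ⟨r, hr, hcl⟩ := h
  refine ⟨fun x => {y | r y x}ᶜ, fun x => (hcl x).isOpen_compl.mem_nhds (irrefl_of r x),
    fun Y hY => ?_⟩
  have hne := hY.nonempty
  refine ⟨hr.wf.min Y hne, hr.wf.min_mem Y hne, ?_⟩
  refine (hY.sdiff (finite_singleton (hr.wf.min Y hne))).mono fun x hx => ⟨hx.1, ?_⟩
  rw [mem_compl_iff, not_not, mem_ofPred_eq]
  rcases trichotomous_of r (hr.wf.min Y hne) x with h | h | h
  · exact h
  · exact absurd h.symm hx.2
  · exact absurd h (hr.wf.not_lt_min Y hx.1)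

/-- Finitely many points share a base set `V z`, and a point `p` lies in countably many base sets,
so only countably many `z` have `p ∈ V z`. A set closed under adding these `z` contains each `x` in
its closure, because `V x` meets it. -/
theorem HasGSNeighborhoodAssignment.isLeftSeparated [T1Space X] {B : Set (Set X)}
    (hB : IsPointCountableBase B) (h : HasGSNeighborhoodAssignment X) : IsLeftSeparated X := by
  obtain ⟨U, hU, hinf⟩ := h
  choose V hVB hxV hVU using fun x => hB.1.mem_nhds_iff.1 (hU x)
  have hfin : ∀ W, {z | V z = W}.Finite := by
    intro W
    by_contra hW
    obtain ⟨y, hy, hy'⟩ := hinf _ hW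
    obtain ⟨x, hx, hyx⟩ := hy'.nonempty
    refine hyx (hVU x ?_)
    rw [show V x = W from hx, ← show V y = W from hy]
    exact hxV y
  refine isLeftSeparated_of_closedUnder (F := fun t => ⋃ p ∈ t, {z | p ∈ V z}) (fun t => ?_)
    fun C hC => ?_
  · refine t.countable_toSet.biUnion fun p _ => ?_
    refine ((hB.2 p).biUnion fun W _ => (hfin W).countable).mono fun z hz => ?_
    exact mem_biUnion (x := V z) ⟨hVB z, hz⟩ rfl
  · refine isClosed_of_closure_subset fun x hx => ?_
    obtain ⟨p, hpV, hpC⟩ := mem_closure_iff.1 hx _ (hB.1.isOpen (hVB x)) (hxV x)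
    refine hC {p} (by simpa using hpC) ?_
    simpa using hpV

end LeftSeparated

/-! ### Ramsey argument for convergent sequences -/

section Homogeneous

variable {X : Type*} [TopologicalSpace X]

theorem IsPointCountableBase.isCountablyGenerated_nhds {B : Set (Set X)}
    (hB : IsPointCountableBase B) (x : X) : (𝓝 x).IsCountablyGenerated :=
  (HasCountableBasis.mk hB.1.nhds_hasBasis (hB.2 x)).isCountablyGenerated

/-- A sequence converging to `x` for which `d` is constant on the pairs of points of the sequence
and its limit. -/
def IsHomogeneousSeq {L : Type*} (d : X → X → L) (i : L) (y : ℕ → X) (x : X) : Prop :=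
  Tendsto y atTop (𝓝 x) ∧ (∀ n, y n ≠ x ∧ d (y n) x = i) ∧
    ∀ m n, m < n → y m ≠ y n ∧ d (y m) (y n) = i

/-- Induction on the possible colors `I`. Call a family large if it meets the closed sets of every
countable-valued `F`. If some `R' V T` is large, it avoids the color `i` and the induction applies;
otherwise a sequence of color `i` is built inside a single `C`. -/
theorem exists_isHomogeneousSeq {B : Set (Set X)} (hB : IsPointCountableBase B) {L : Type*}
    (d : X → X → L) (I : Finset L) :
    ∀ P : Set (Set X × X), (∀ q ∈ P, q.2 ∈ closure q.1 ∧ q.2 ∉ q.1) →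
      (∀ F : Finset X → Set X, (∀ t, (F t).Countable) → ∃ q ∈ P, ClosedUnder F q.1) →
      (∀ q ∈ P, ∀ q' ∈ P, q'.2 ∈ q.1 → d q'.2 q.2 ∈ I) →
      ∃ i y x, IsHomogeneousSeq d i y x := by
  classical
  induction I using Finset.induction with
  | empty =>
    intro P _ hlarge hI
    obtain ⟨p, hp, -⟩ := hlarge (fun _ => ∅) fun _ => countable_empty
    obtain ⟨q, hq, hqF⟩ := hlarge (fun _ => {p.2}) fun _ => countable_singleton _
    exact absurd (hI q hq p hp (hqF ∅ (by simp) rfl)) (Finset.notMem_empty _)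
  | insert i I _ ih =>
    intro P hP hlarge hI
    let R : Set X → Finset X → Set (Set X × X) := fun V T =>
      {q ∈ P | q.2 ∈ V ∧ ∀ y ∈ T, y ∈ q.1 ∧ d y q.2 = i}
    let R' : Set X → Finset X → Set (Set X × X) := fun V T =>
      {q ∈ R V T | ∀ q' ∈ R V T, q'.2 ∈ q.1 → d q'.2 q.2 ≠ i}
    by_cases hR : ∃ V T, ∀ F : Finset X → Set X, (∀ t, (F t).Countable) →
        ∃ q ∈ R' V T, ClosedUnder F q.1
    · obtain ⟨V, T, hVT⟩ := hR
      refine ih (R' V T) (fun q hq => hP q hq.1.1) hVT fun q hq q' hq' hmem => ?_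
      exact (Finset.mem_insert.1 (hI q hq.1.1 q' hq'.1.1 hmem)).resolve_left
        (hq.2 q' hq'.1 hmem)
    · push Not at hR
      choose F hFc hF using hR
      -- Point-countability keeps `G` countable-valued. Each base set around `x` contains some `p ∈
      -- C`, so closure under `G` captures every relevant `F V T`, although `x ∉ C`.
      let G : Finset X → Set X := fun t => ⋃ p ∈ t, ⋃ V ∈ {U ∈ B | p ∈ U},
        ⋃ s ∈ t.powerset, ⋃ u ∈ t.powerset, F V s u
      obtain ⟨⟨C, x⟩, hq, hG⟩ := hlarge G fun t =>
        t.countable_toSet.biUnion fun p _ => (hB.2 p).biUnion fun V _ =>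
          t.powerset.countable_toSet.biUnion fun s _ =>
            t.powerset.countable_toSet.biUnion fun u _ => hFc V s u
      have hx := hP _ hq
      have hCF : ∀ V ∈ B, x ∈ V → ∀ T : Finset X, (T : Set X) ⊆ C → ClosedUnder (F V T) C := by
        intro V hV hxV T hT u hu
        obtain ⟨p, hpV, hpC⟩ := mem_closure_iff.1 hx.1 V (hB.1.isOpen hV) hxV
        refine Subset.trans ?_ (hG (insert p (T ∪ u)) ?_)
        · intro z hz
          simp only [G, mem_iUnion]
          refine ⟨p, Finset.mem_insert_self _ _, V, ⟨hV, hpV⟩, T, ?_, u, ?_, hz⟩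
          · exact Finset.mem_powerset.2
              (Finset.subset_union_left.trans (Finset.subset_insert _ _))
          · exact Finset.mem_powerset.2
              (Finset.subset_union_right.trans (Finset.subset_insert _ _))
        · rw [Finset.coe_insert, Finset.coe_union]
          exact insert_subset hpC (union_subset hT hu)
      have hstep : ∀ V ∈ 𝓝 x, ∀ T : Finset X, (∀ t ∈ T, t ∈ C ∧ d t x = i) →
          ∃ y ∈ C, y ∈ V ∧ d y x = i ∧ ∀ t ∈ T, t ≠ y ∧ d t y = i := by
        intro V hV T hT
        obtain ⟨W, hWB, hxW, hWV⟩ := hB.1.mem_nhds_iff.1 hV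
        have hCR : (C, x) ∈ R W T := ⟨hq, hxW, hT⟩
        have hn : (C, x) ∉ R' W T := fun h =>
          hF W T _ h (hCF W hWB hxW T fun t ht => (hT t ht).1)
        have : ∃ q' ∈ R W T, q'.2 ∈ C ∧ d q'.2 x = i := by
          by_contra! h
          exact hn ⟨hCR, h⟩
        obtain ⟨q', hq', hC', hd'⟩ := this
        refine ⟨q'.2, hC', hWV hq'.2.1, hd', fun t ht => ⟨?_, (hq'.2.2 t ht).2⟩⟩
        rintro rfl
        exact (hP q' hq'.1).2 (hq'.2.2 _ ht).1
      have := hB.isCountablyGenerated_nhds x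
      obtain ⟨W, hW⟩ := (𝓝 x).exists_antitone_basis
      obtain ⟨f, hf, hfr⟩ := exists_seq_of_forall_finset_exists
        -- The second coordinate indexes a shrinking neighborhood of `x`; its strict growth forces
        -- convergence.
        (fun a : X × ℕ => a.1 ∈ C ∧ a.1 ∈ W a.2 ∧ d a.1 x = i)
        (fun a b => a.2 < b.2 ∧ a.1 ≠ b.1 ∧ d a.1 b.1 = i) (by
          intro s hs
          obtain ⟨N, hN⟩ : ∃ N, ∀ a ∈ s, a.2 < N :=
            ⟨s.sup Prod.snd + 1, fun a ha => Nat.lt_succ_of_le (Finset.le_sup (f := Prod.snd) ha)⟩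
          obtain ⟨y, hyC, hyW, hyx, hy⟩ := hstep (W N) (hW.mem N) (s.image Prod.fst) (by
            intro t ht
            obtain ⟨a, ha, rfl⟩ := Finset.mem_image.1 ht
            exact ⟨(hs a ha).1, (hs a ha).2.2⟩)
          exact ⟨(y, N), ⟨hyC, hyW, hyx⟩, fun a ha =>
            ⟨hN a ha, hy _ (Finset.mem_image_of_mem _ ha)⟩⟩)
      have hmono : StrictMono fun n => (f n).2 := fun m n hmn => (hfr m n hmn).1
      refine ⟨i, fun n => (f n).1, x, ?_, fun n => ⟨?_, (hf n).2.2⟩, fun m n hmn => (hfr m n hmn).2⟩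
      · refine hW.tendsto fun n => ?_
        exact hW.antitone (hmono.le_apply) (hf n).2.1
      · intro h
        exact hx.2 (h ▸ (hf n).1)

end Homogeneous

/-! ### Copies of `ω + 1` and the partition relation -/

section OmegaPlusOne

theorem natCast_lt_omega0_add_one (n : ℕ) : (n : Ordinal.{0}) < Ordinal.omega0 + 1 :=
  (Ordinal.natCast_lt_omega0 n).trans (lt_add_one _)

theorem tendsto_natCast_omega0 :
    Tendsto (fun n : ℕ => (n : Ordinal.{0})) atTop (𝓝 Ordinal.omega0) := by
  refine tendsto_order.2 ⟨fun a ha => ?_, fun a ha => ?_⟩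
  · obtain ⟨N, rfl⟩ := Ordinal.lt_omega0.1 ha
    filter_upwards [eventually_gt_atTop N] with n hn
    exact_mod_cast hn
  · exact Eventually.of_forall fun n => (Ordinal.natCast_lt_omega0 n).trans ha

instance : CompactSpace OmegaPlusOne := by
  refine isCompact_iff_compactSpace.1 ?_
  have : Set.Iio (Ordinal.omega0.{0} + 1) = Set.Icc 0 Ordinal.omega0 := by
    ext a
    simp [Order.lt_add_one_iff]
  rw [this]
  exact isCompact_Icc

variable {X : Type*} [TopologicalSpace X]

theorem exists_homeomorph_omegaPlusOne [T2Space X] {y : ℕ → X} {x : X}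
    (hy : Tendsto y atTop (𝓝 x)) (hinj : Function.Injective y) (hne : ∀ n, y n ≠ x) :
    Nonempty ((insert x (range y) : Set X) ≃ₜ OmegaPlusOne) := by
  classical
  let G : Ordinal.{0} → X := fun a => if h : a < Ordinal.omega0 then
    y (Ordinal.lt_omega0.1 h).choose else x
  have hGn : ∀ n : ℕ, G n = y n := by
    intro n
    have h := Ordinal.natCast_lt_omega0.{0} n
    have h2 : n = (Ordinal.lt_omega0.1 h).choose := by
      exact_mod_cast (Ordinal.lt_omega0.1 h).choose_spec
    simp only [G, dif_pos h, ← h2]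
  have hGω : ∀ a, Ordinal.omega0 ≤ a → G a = x := fun a ha => dif_neg ha.not_gt
  have hcases : ∀ a : OmegaPlusOne, (∃ n : ℕ, (a : Ordinal) = n) ∨
      (a : Ordinal) = Ordinal.omega0 := by
    rintro ⟨a, ha⟩
    rcases (Order.lt_add_one_iff.1 (mem_Iio.1 ha)).lt_or_eq with h | h
    · exact Or.inl (Ordinal.lt_omega0.1 h)
    · exact Or.inr h
  have hcont : Continuous fun a : OmegaPlusOne => G a := by
    refine continuous_iff_continuousAt.2 fun a => ?_
    refine ContinuousAt.comp (f := Subtype.val) (g := G) ?_ continuous_subtype_val.continuousAt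
    rcases hcases a with ⟨n, hn⟩ | h
    · have : 𝓝 (a : Ordinal) = pure (a : Ordinal) := by
        rw [hn, SuccOrder.nhds_eq_pure]
        exact fun h => (Ordinal.omega0_le_of_isSuccLimit h).not_gt (Ordinal.natCast_lt_omega0 n)
      rw [ContinuousAt, this]
      exact tendsto_pure_nhds _ _
    · rw [ContinuousAt, h, hGω _ le_rfl]
      intro s hs
      obtain ⟨N, hN⟩ := eventually_atTop.1 (hy hs)
      rw [mem_map]
      filter_upwards [Ioi_mem_nhds (Ordinal.natCast_lt_omega0 N)] with b hb
      rcases lt_or_ge b Ordinal.omega0 with hbω | hbω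
      · obtain ⟨n, rfl⟩ := Ordinal.lt_omega0.1 hbω
        rw [mem_preimage, hGn]
        exact hN n (by exact_mod_cast (mem_Ioi.1 hb).le)
      · rw [mem_preimage, hGω b hbω]
        exact mem_of_mem_nhds hs
  have hGinj : Function.Injective fun a : OmegaPlusOne => G a := by
    intro a b hab
    refine Subtype.ext ?_
    simp only at hab
    rcases hcases a with ⟨n, hn⟩ | ha <;> rcases hcases b with ⟨m, hm⟩ | hb
    · rw [hn, hm, hGn, hGn] at hab
      rw [hn, hm, hinj hab]
    · rw [hn, hb, hGn, hGω _ le_rfl] at hab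
      exact absurd hab (hne n)
    · rw [ha, hm, hGn, hGω _ le_rfl] at hab
      exact absurd hab.symm (hne m)
    · rw [ha, hb]
  have hrange : range (fun a : OmegaPlusOne => G a) = insert x (range y) := by
    refine Subset.antisymm ?_ (insert_subset ?_ ?_)
    · rintro _ ⟨a, rfl⟩
      rcases hcases a with ⟨n, hn⟩ | ha
      · exact Or.inr ⟨n, by simp only [hn, hGn]⟩
      · exact Or.inl (by simp only [ha, hGω _ le_rfl])
    · exact ⟨⟨Ordinal.omega0, mem_Iio.2 (lt_add_one _)⟩, hGω _ le_rfl⟩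
    · rintro _ ⟨n, rfl⟩
      exact ⟨⟨n, natCast_lt_omega0_add_one n⟩, hGn n⟩
  rw [← hrange]
  -- A continuous injection from a compact space to a Hausdorff one is an embedding.
  exact ⟨(hcont.isClosedEmbedding hGinj).isEmbedding.toHomeomorph.symm⟩

theorem exists_tendsto_of_homeomorph_omegaPlusOne {Y : Set X} (e : Y ≃ₜ OmegaPlusOne) :
    ∃ (y : ℕ → X) (x : X), x ∈ Y ∧ (∀ n, y n ∈ Y) ∧ (∀ n, y n ≠ x) ∧ Function.Injective y ∧
      Tendsto y atTop (𝓝 x) := by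
  let p : ℕ → OmegaPlusOne := fun n => ⟨n, natCast_lt_omega0_add_one n⟩
  let t : OmegaPlusOne := ⟨Ordinal.omega0, mem_Iio.2 (lt_add_one _)⟩
  have hp : Tendsto p atTop (𝓝 t) := tendsto_subtype_rng.2 tendsto_natCast_omega0
  refine ⟨fun n => e.symm (p n), e.symm t, Subtype.coe_prop _, fun n => Subtype.coe_prop _,
    fun n h => ?_, fun m n h => ?_, ?_⟩
  · have h1 := congrArg Subtype.val (e.symm.injective (Subtype.ext h))
    exact (Ordinal.natCast_lt_omega0 n).ne h1
  · have h1 := congrArg Subtype.val (e.symm.injective (Subtype.ext h))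
    exact Nat.cast_injective (R := Ordinal.{0}) h1
  · exact (continuous_subtype_val.tendsto _).comp ((e.symm.continuous.tendsto t).comp hp)

theorem IsLeftSeparated.not_topArrow [RegularSpace X] (h : IsLeftSeparated X) :
    ¬ TopArrow X OmegaPlusOne 2 3 1 := by
  classical
  obtain ⟨r, hr, hcl⟩ := h
  have hW : ∀ x, ∃ W ∈ 𝓝 x, IsClosed W ∧ W ⊆ {y | r y x}ᶜ := fun x =>
    exists_mem_nhds_isClosed_subset ((hcl x).isOpen_compl.mem_nhds (irrefl_of r x))
  choose W hWx hWc hWr using hW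
  intro harrow
  -- Two colors suffice: 0 says that the later point lies in the closed neighborhood `W` of the
  -- earlier one.
  obtain ⟨Y, T, ⟨e⟩, hT, hc⟩ := harrow (Fin 3) (by simp) fun v =>
    if ∃ a ∈ v.1, ∃ b ∈ v.1, r a b ∧ b ∈ W a then 0 else 1
  obtain ⟨y, x, hxY, hyY, hne, hinj, hlim⟩ := exists_tendsto_of_homeomorph_omegaPlusOne e
  obtain ⟨N, hN⟩ := eventually_atTop.1 (hlim (hWx x))
  have hxr : ∀ n ≥ N, r x (y n) := by
    intro n hn
    rcases trichotomous_of r x (y n) with h | h | h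
    · exact h
    · exact absurd h.symm (hne n)
    · exact absurd h (hWr x (hN n hn))
  have hsub : T.Subsingleton := by
    have : Subsingleton T := Cardinal.le_one_iff_subsingleton.1 (by rw [hT, Nat.cast_one])
    exact subsingleton_coe T |>.1 this
  have hmem : ∀ a ∈ Y, ∀ b ∈ Y, a ≠ b →
      (if ∃ a' ∈ ({a, b} : Finset X), ∃ b' ∈ ({a, b} : Finset X), r a' b' ∧ b' ∈ W a'
        then (0 : Fin 3) else 1) ∈ T := by
    intro a ha b hb hab
    exact hc ⟨{a, b}, Finset.card_pair hab⟩ (by simp [insert_subset_iff, ha, hb])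
  have h0 : (0 : Fin 3) ∈ T := by
    have := hmem x hxY (y N) (hyY N) (hne N).symm
    rwa [if_pos ⟨x, by simp, y N, by simp, hxr N le_rfl, hN N le_rfl⟩] at this
  have hpair : ∀ a ∈ Y, ∀ b ∈ Y, r a b → b ∈ W a := by
    intro a ha b hb hab
    have hne' : a ≠ b := by
      rintro rfl
      exact irrefl_of r a hab
    have h1 := hmem a ha b hb hne'
    split_ifs at h1 with hex
    · obtain ⟨a', ha', b', hb', hr', hw⟩ := hex
      simp only [Finset.mem_insert, Finset.mem_singleton] at ha' hb'
      rcases ha' with rfl | rfl <;> rcases hb' with rfl | rfl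
      · exact absurd hr' (irrefl_of r _)
      · exact hw
      · exact absurd hr' (asymm_of r hab)
      · exact absurd hr' (irrefl_of r _)
    · exact absurd (hsub h0 h1) (by decide)
  let S : Set X := y '' Ici N
  have hS : S.Nonempty := ⟨y N, N, mem_Ici.2 le_rfl, rfl⟩
  obtain ⟨k, hk, hky⟩ := hr.wf.min_mem S hS
  have hmin : ∀ n ≥ N, ¬ r (y n) (y k) := by
    intro n hn
    rw [hky]
    exact hr.wf.not_lt_min S ⟨n, hn, rfl⟩
  -- With `y k` least in the tail, all later terms lie in the closed set `W (y k)`, hence so does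
  -- `x`. But `x` precedes `y k`.
  have hxW : x ∈ W (y k) := by
    refine (hWc _).mem_of_tendsto hlim ?_
    filter_upwards [eventually_ge_atTop N, eventually_gt_atTop k] with n hn hkn
    refine hpair _ (hyY k) _ (hyY n) ?_
    rcases trichotomous_of r (y k) (y n) with h | h | h
    · exact h
    · exact absurd (hinj h) hkn.ne
    · exact absurd h (hmin n hn)
  exact hWr _ hxW (hxr k hk)

theorem topArrow_of_not_isLeftSeparated [T2Space X] {B : Set (Set X)}
    (hB : IsPointCountableBase B) (h : ¬ IsLeftSeparated X) (k : ℕ) :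
    TopArrow X OmegaPlusOne 2 k 1 := by
  classical
  intro L hL c
  have hLfin : Finite L := Cardinal.mk_lt_aleph0_iff.1 (hL ▸ Cardinal.natCast_lt_aleph0)
  have := Fintype.ofFinite L
  -- `none` serves only the diagonal, where no pair exists to color.
  let d : X → X → Option L := fun a b =>
    if hab : a ≠ b then some (c ⟨{a, b}, Finset.card_pair hab⟩) else none
  have hd : ∀ a b, d a b = d b a := by
    intro a b
    by_cases hab : a = b
    · rw [hab]
    · simp only [d, ne_eq, hab, Ne.symm hab, not_false_eq_true, dif_pos, Finset.pair_comm]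
  obtain ⟨i, y, x, hlim, hyx, hyy⟩ := exists_isHomogeneousSeq hB d Finset.univ
    {q | q.2 ∈ closure q.1 ∧ q.2 ∉ q.1} (fun _ hq => hq) (by
      intro F hF
      by_contra! hno
      refine h (isLeftSeparated_of_closedUnder hF fun C hC =>
        isClosed_of_closure_subset fun x hx => ?_)
      by_contra hxC
      exact hno (C, x) ⟨hx, hxC⟩ hC) fun _ _ _ _ _ => Finset.mem_univ _
  have hinj : Function.Injective y := by
    intro m n hmn
    rcases lt_trichotomy m n with h | h | h
    · exact absurd hmn (hyy m n h).1
    · exact h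
    · exact absurd hmn.symm (hyy n m h).1
  have hconst : ∀ a ∈ insert x (range y), ∀ b ∈ insert x (range y), a ≠ b → d a b = i := by
    rintro _ (rfl | ⟨m, rfl⟩) _ (rfl | ⟨n, rfl⟩) hab
    · exact absurd rfl hab
    · rw [hd]
      exact (hyx n).2
    · exact (hyx m).2
    · rcases lt_trichotomy m n with h | h | h
      · exact (hyy m n h).2
      · exact absurd (congrArg y h) hab
      · rw [hd]
        exact (hyy n m h).2
  have h0 := (hyx 0).2
  simp only [d, dif_pos (hyx 0).1] at h0
  refine ⟨insert x (range y), {c ⟨{y 0, x}, Finset.card_pair (hyx 0).1⟩},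
    exists_homeomorph_omegaPlusOne hlim hinj fun n => (hyx n).1, by simp, ?_⟩
  rintro ⟨v, hv⟩ hvY
  obtain ⟨a, b, hab, rfl⟩ := Finset.card_eq_two.1 hv
  have h1 := hconst a (hvY (by simp)) b (hvY (by simp)) hab
  simp only [d, dif_pos hab] at h1
  exact Option.some_injective _ (h1.trans h0.symm)

end OmegaPlusOne

theorem mainTheorem9 (X : Type*) [TopologicalSpace X] [T3Space X]
    (hX : ∃ B : Set (Set X), IsPointCountableBase B) :
    List.TFAE
      [HasGSNeighborhoodAssignment X,
       IsLeftSeparated X,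
       ¬ TopArrow X OmegaPlusOne 2 3 1] := by
  obtain ⟨B, hB⟩ := hX
  tfae_have 1 → 2 := fun h => h.isLeftSeparated hB
  tfae_have 2 → 1 := fun h => h.hasGSNeighborhoodAssignment
  tfae_have 2 → 3 := fun h => h.not_topArrow
  tfae_have 3 → 2 := fun h => by
    by_contra h'
    exact h (topArrow_of_not_isLeftSeparated hB h' 3)
  tfae_finish
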